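/- Let $d\ge 2$. For $k \ge 1$, a $k$-simplex in $\mathbb R^d$ is the convex hull $S=\operatorname{conv}\{A_0,\dots,A_k\}$ of $k+1$ affinely independent points, its vertices; $F_i$ denotes its facet opposite to $A_i$, i.e. the convex hull of the other vertices. For $k\ge 2$ and $i\ne j$, the dihedral angle $\beta_{ij}\in[0,\pi]$ between $F_i$ and $F_j$ is defined by $\cos\beta_{ij}=-\,n_i\cdot n_j$, where $n_i,n_j$ are the outward unit normals of $F_i,F_j$ within the affine span of $S$. For a $d$-simplex $S$, the $d$-sine of the angle of $S$ at the vertex $A_i$ is $$\sin_d(\hat A_i\,|\,A_0A_1\dots A_d)=\frac{d^{\,d-1}\,(\operatorname{meas}_d S)^{d-1}}{(d-1)!\,\prod_{j=0,\,j\ne i}^{d}\operatorname{meas}_{d-1}F_j}.$$ Let $\overline\Omega\subset\mathbb R^d$ be a polytope (the closure of a bounded domain, not necessarily convex, with $\partial\overline\Omega$ contained in finitely many hyperplanes), and let $\mathcal F$ be any family of partitions $\mathcal T$ of $\overline\Omega$ into finitely many $d$-simplices with pairwise disjoint interiors (the partitions need not be face-to-face). Then the following two conditions are equivalent. 1. ($d$-dimensional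 minimum angle condition) There is a constant $\alpha_0>0$ such that for every $\mathcal T\in\mathcal F$, every $S\in\mathcal T$ and every subsimplex $S'\subseteq S$ of dimension at least $2$ whose vertices are vertices of $S$ (including $S'=S$), all dihedral angles of $S'$ are at least $\alpha_0$. 2. (Generalized minimum angle condition) There is a constant $C>0$ such that for every $\mathcal T\in\mathcal F$, every $S=\operatorname{conv}\{A_0,\dots,A_d\}\in\mathcal T$ and every $i\in\{0,\dots,d\}$, $$\sin_d(\hat A_i\,|\,A_0A_1\dots A_d)\ge C.$$ -/

import Mathlib

namespace SimplicialMesh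

noncomputable section

section Simplex

variable {E : Type*} [NormedAddCommGroup E] [InnerProductSpace ℝ E] {k : ℕ}

/-- `v` is the outward unit normal of the facet of the `k`-simplex `S` opposite to the vertex `i`,
inside the affine span of `S`: a unit vector, parallel to `S`, orthogonal to the facet, and
pointing from the vertex `i` towards the facet. -/
structure IsOutwardUnitNormal [NeZero k] (S : Affine.Simplex ℝ E k) (i : Fin (k + 1))
    (v : E) : Prop where
  mem_vectorSpan : v ∈ vectorSpan ℝ (Set.range S.points)
  norm_eq_one : ‖v‖ = 1
  orthogonal : ∀ w ∈ vectorSpan ℝ (Set.range (S.faceOpposite i).points), inner ℝ v w = 0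
  outward : ∀ p ∈ (S.faceOpposite i).closedInterior, 0 < inner ℝ v (p - S.points i)

/-- The outward unit normal of the facet opposite to the vertex `i`, as the normalized vector from
the vertex to the foot of its altitude. -/
def outwardUnitNormal [NeZero k] (S : Affine.Simplex ℝ E k) (i : Fin (k + 1)) : E :=
  (S.height i)⁻¹ • (S.altitudeFoot i - S.points i)

/-- `outwardUnitNormal S i` is the one and only outward unit normal of that facet. -/
theorem isOutwardUnitNormal_iff [NeZero k] (S : Affine.Simplex ℝ E k) (i : Fin (k + 1)) (v : E) :
    IsOutwardUnitNormal S i v ↔ v = outwardUnitNormal S i := by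
  have hpos := S.height_pos i
  have hh : S.height i = ‖S.altitudeFoot i - S.points i‖ := by
    rw [Affine.Simplex.height, dist_comm, dist_eq_norm]
  have horth : ∀ w ∈ vectorSpan ℝ (Set.range (S.faceOpposite i).points),
      inner ℝ (S.altitudeFoot i - S.points i) w = 0 := by
    intro w hw
    rw [← direction_affineSpan] at hw
    exact Submodule.inner_left_of_mem_orthogonal hw
      (EuclideanGeometry.orthogonalProjection_vsub_mem_direction_orthogonal _ _)
  have hout : ∀ p ∈ (S.faceOpposite i).closedInterior,
      inner ℝ (S.altitudeFoot i - S.points i) (p - S.points i) = S.height i ^ 2 := by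
    intro p hp
    have h := horth (p - S.altitudeFoot i) (vsub_mem_vectorSpan_of_mem_affineSpan_of_mem_affineSpan
      ((S.faceOpposite i).closedInterior_subset_affineSpan hp)
      (S.altitudeFoot_mem_affineSpan_faceOpposite i))
    rw [hh, ← real_inner_self_eq_norm_sq,
      show p - S.points i = (p - S.altitudeFoot i) + (S.altitudeFoot i - S.points i) by abel,
      inner_add_right, h, zero_add]
  constructor
  · intro hv
    have hmem : v ∈ (S.altitude i).direction := by
      rw [S.direction_altitude]
      refine ⟨?_, hv.mem_vectorSpan⟩
      rw [SetLike.mem_coe, Submodule.mem_orthogonal']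
      intro w hw
      exact hv.orthogonal w (by rwa [S.range_faceOpposite_points])
    rw [← S.affineSpan_pair_altitudeFoot_eq_altitude, direction_affineSpan,
      mem_vectorSpan_pair] at hmem
    obtain ⟨c, rfl⟩ := hmem
    rw [vsub_eq_sub] at hv
    obtain ⟨p, hp⟩ : (S.faceOpposite i).closedInterior.Nonempty :=
      ⟨_, (S.faceOpposite i).point_mem_closedInterior 0⟩
    have h1 := hv.outward p hp
    have h2 := hv.norm_eq_one
    rw [inner_smul_left, hout p hp] at h1
    have hc : 0 < c := by
      have : (0 : ℝ) < S.height i ^ 2 := by positivity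
      simpa [this] using h1
    rw [norm_smul, ← hh, Real.norm_of_nonneg hc.le] at h2
    rw [outwardUnitNormal, vsub_eq_sub, eq_inv_of_mul_eq_one_left h2]
  · rintro rfl
    refine ⟨Submodule.smul_mem _ _ (vsub_mem_vectorSpan_of_mem_affineSpan_of_mem_affineSpan
      (S.altitudeFoot_mem_affineSpan i) (mem_affineSpan ℝ (Set.mem_range_self i))), ?_, ?_, ?_⟩
    · rw [outwardUnitNormal, norm_smul, ← hh, norm_inv, Real.norm_of_nonneg hpos.le,
        inv_mul_cancel₀ hpos.ne']
    · intro w hw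
      rw [outwardUnitNormal, inner_smul_left, horth w hw, mul_zero]
    · intro p hp
      rw [outwardUnitNormal, inner_smul_left, hout p hp]
      simp only [conj_trivial]
      positivity

/-- The dihedral angle between the facets opposite to the vertices `i` and `j` of a simplex of
dimension at least two: the angle in `[0, π]` whose cosine is `- nᵢ · nⱼ`. -/
def dihedralAngle [k.AtLeastTwo] (S : Affine.Simplex ℝ E k) (i j : Fin (k + 1)) : ℝ :=
  Real.arccos (-inner ℝ (outwardUnitNormal S i) (outwardUnitNormal S j))

variable [MeasurableSpace E] [BorelSpace E]

/-- The `k`-dimensional measure of a `k`-simplex. -/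
def meas (S : Affine.Simplex ℝ E k) : ℝ :=
  (MeasureTheory.Measure.euclideanHausdorffMeasure k S.closedInterior).toReal

/-- The `k`-dimensional sine of the angle of a `k`-simplex (`2 ≤ k`) at its vertex `i`. -/
def dSine [k.AtLeastTwo] (S : Affine.Simplex ℝ E k) (i : Fin (k + 1)) : ℝ :=
  ((k : ℝ) ^ (k - 1) * meas S ^ (k - 1)) /
    (((k - 1).factorial : ℝ) * ∏ j ∈ Finset.univ.erase i, meas (S.faceOpposite j))

end Simplex

section Partition

variable {d : ℕ}

/-- A polytope in `ℝᵈ` (not necessarily convex): the closure of a bounded domain, with boundary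
contained in finitely many hyperplanes. -/
def IsPolytope (Ω : Set (EuclideanSpace ℝ (Fin d))) : Prop :=
  (∃ U : Set (EuclideanSpace ℝ (Fin d)),
    IsOpen U ∧ IsConnected U ∧ Bornology.IsBounded U ∧ closure U = Ω) ∧
  ∃ 𝓗 : Set (AffineSubspace ℝ (EuclideanSpace ℝ (Fin d))), 𝓗.Finite ∧
    (∀ H ∈ 𝓗, Module.finrank ℝ H.direction + 1 = d) ∧
    frontier Ω ⊆ ⋃ H ∈ 𝓗, (H : Set (EuclideanSpace ℝ (Fin d)))

/-- A partition of `Ω` into finitely many `d`-simplices with pairwise disjoint interiors. Each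
simplex comes with some labelling `A₀, …, A_d` of its vertices (exactly one labelling, since the
interiors are disjoint). -/
structure IsSimplicialPartition (Ω : Set (EuclideanSpace ℝ (Fin d)))
    (T : Set (Affine.Simplex ℝ (EuclideanSpace ℝ (Fin d)) d)) : Prop where
  finite : T.Finite
  iUnion_eq : ⋃ S ∈ T, S.closedInterior = Ω
  disjoint : ∀ S ∈ T, ∀ S' ∈ T, S ≠ S' →
    Disjoint (interior S.closedInterior) (interior S'.closedInterior)

/-- The `d`-dimensional minimum angle condition. The subsimplex of `S` with vertex set `V` is
`S.face hV`; it has dihedral angles when its dimension `k` is at least two. -/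
def MinimumAngleCondition (F : Set (Set (Affine.Simplex ℝ (EuclideanSpace ℝ (Fin d)) d))) : Prop :=
  ∃ α₀ : ℝ, 0 < α₀ ∧ ∀ T ∈ F, ∀ S ∈ T,
    ∀ (k : ℕ) [k.AtLeastTwo] (V : Finset (Fin (d + 1))) (hV : V.card = k + 1) (i j : Fin (k + 1)),
      i ≠ j → α₀ ≤ dihedralAngle (S.face hV) i j

/-- The generalized minimum angle condition. -/
def GeneralizedMinimumAngleCondition [d.AtLeastTwo]
    (F : Set (Set (Affine.Simplex ℝ (EuclideanSpace ℝ (Fin d)) d))) : Prop :=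
  ∃ C : ℝ, 0 < C ∧ ∀ T ∈ F, ∀ S ∈ T, ∀ i : Fin (d + 1), C ≤ dSine S i

end Partition

end

end SimplicialMesh

/-! Both conditions are equivalent, with constants depending only on the dimension and the given
bound, to `HeightRegular`: every height is at least a fixed multiple of every edge.

Angles give regularity by induction on the dimension. By `height_eq_sin_dihedralAngle_mul`, a height
of `S` is the sine of a dihedral angle times a height of a facet, and the facets are regular by
induction. A lower bound on the angle does not bound its sine, since the angle may be close to `π`.
However, the foot of the altitude from `A_i` has some barycentric coordinate `w_j` bounded below,
and `h_i cos β_ij = w_j h_j` then makes `β_ij` acute and `h_j` at most a multiple of `h_i`.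
Conversely, regularity bounds each sine of a dihedral angle below, hence the angle, and passes to
subsimplices because heights can only grow there.

For the `d`-sine, volume is a constant times height times base. Regularity bounds the volume below
and the facets above by powers of the diameter, and these powers cancel in the sine. Conversely,
`exists_dSine_mul_dist_le` cancels all facets but one from the quotient and bounds the last one
below, leaving at most a constant times `h_j / |A_i A_j|`. The triangle inequality through `A_j`
then controls every edge by `h_j`. -/

namespace SimplicialMesh

/-! ### Heights, normals and dihedral angles -/

section Geometry

variable {E : Type*} [NormedAddCommGroup E] [InnerProductSpace ℝ E] {k n : ℕ}

/-- The simplex on the vertices of `S` selected by the order embedding `e`. -/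
def subsimplex {m : ℕ} (S : Affine.Simplex ℝ E k) (e : Fin (m + 1) ↪o Fin (k + 1)) :
    Affine.Simplex ℝ E m :=
  ⟨S.points ∘ e, S.independent.comp_embedding e.toEmbedding⟩

theorem face_eq_subsimplex {m : ℕ} (S : Affine.Simplex ℝ E k) {V : Finset (Fin (k + 1))}
    (hV : V.card = m + 1) : S.face hV = subsimplex S (V.orderEmbOfFin hV) := rfl

theorem subsimplex_eq_face {m : ℕ} (S : Affine.Simplex ℝ E k) (e : Fin (m + 1) ↪o Fin (k + 1)) :
    subsimplex S e = S.face (fs := Finset.univ.map e.toEmbedding) (by simp) := by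
  rw [face_eq_subsimplex]
  congr 1
  exact Finset.orderEmbOfFin_unique' _ (by simp)

theorem faceOpposite_points (S : Affine.Simplex ℝ E (n + 1)) (i : Fin (n + 2)) (j : Fin (n + 1)) :
    (S.faceOpposite i).points j = S.points (i.succAbove j) :=
  S.faceOpposite_point_eq_point_succAbove i j

theorem faceOpposite_eq_subsimplex (S : Affine.Simplex ℝ E (n + 1)) (i : Fin (n + 2)) :
    S.faceOpposite i = subsimplex S i.succAboveOrderEmb := by
  ext j
  exact faceOpposite_points S i j

section Normal

variable [NeZero k] (S : Affine.Simplex ℝ E k) (i : Fin (k + 1))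

theorem isOutwardUnitNormal_outwardUnitNormal :
    IsOutwardUnitNormal S i (outwardUnitNormal S i) :=
  (isOutwardUnitNormal_iff S i _).2 rfl

theorem norm_outwardUnitNormal : ‖outwardUnitNormal S i‖ = 1 :=
  (isOutwardUnitNormal_outwardUnitNormal S i).norm_eq_one

theorem height_smul_outwardUnitNormal :
    S.height i • outwardUnitNormal S i = S.altitudeFoot i - S.points i := by
  rw [outwardUnitNormal, smul_inv_smul₀ (S.height_pos i).ne']

theorem inner_outwardUnitNormal_sub {q : E}
    (hq : q ∈ affineSpan ℝ (Set.range (S.faceOpposite i).points)) :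
    inner ℝ (outwardUnitNormal S i) (q - S.points i) = S.height i := by
  have h := (isOutwardUnitNormal_outwardUnitNormal S i).orthogonal (q - S.altitudeFoot i)
    (vsub_mem_vectorSpan_of_mem_affineSpan_of_mem_affineSpan hq
      (S.altitudeFoot_mem_affineSpan_faceOpposite i))
  rw [show q - S.points i = (q - S.altitudeFoot i) + (S.altitudeFoot i - S.points i) by abel,
    inner_add_right, h, ← height_smul_outwardUnitNormal, inner_smul_right,
    real_inner_self_eq_norm_sq, norm_outwardUnitNormal]
  simp

variable {S i}

theorem inner_outwardUnitNormal_points_sub {j : Fin (k + 1)} (h : j ≠ i) :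
    inner ℝ (outwardUnitNormal S i) (S.points j - S.points i) = S.height i :=
  inner_outwardUnitNormal_sub S i (S.points_mem_affineSpan_faceOpposite.2 h)

theorem height_le_norm_sub {q : E}
    (hq : q ∈ affineSpan ℝ (Set.range (S.faceOpposite i).points)) :
    S.height i ≤ ‖q - S.points i‖ := by
  have := real_inner_le_norm (outwardUnitNormal S i) (q - S.points i)
  rwa [inner_outwardUnitNormal_sub S i hq, norm_outwardUnitNormal, one_mul] at this

theorem height_le_dist {j : Fin (k + 1)} (h : j ≠ i) :
    S.height i ≤ dist (S.points i) (S.points j) := by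
  rw [dist_comm, dist_eq_norm]
  exact height_le_norm_sub (S.points_mem_affineSpan_faceOpposite.2 h)

/-- Each vertex other than `i` has normal component `S.height i` relative to vertex `i`, so this
component reads off the barycentric coordinate at `i`. -/
theorem inner_outwardUnitNormal_affineCombination_sub (w : Fin (k + 1) → ℝ) (hw : ∑ j, w j = 1) :
    inner ℝ (outwardUnitNormal S i)
      (Finset.univ.affineCombination ℝ S.points w - S.points i) = (1 - w i) * S.height i := by
  rw [← vsub_eq_sub, ← Finset.sum_smul_vsub_const_eq_affineCombination_vsub _ _ _ _ hw, inner_sum]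
  have h : ∀ j, inner ℝ (outwardUnitNormal S i) (w j • (S.points j -ᵥ S.points i)) =
      w j * S.height i - if j = i then w j * S.height i else 0 := by
    intro j
    rw [inner_smul_right, vsub_eq_sub]
    split_ifs with hj
    · simp [hj]
    · rw [inner_outwardUnitNormal_points_sub hj, sub_zero]
  simp_rw [h, Finset.sum_sub_distrib, ← Finset.sum_mul, hw]
  simp [sub_mul]

theorem mem_vectorSpan_faceOpposite_of_inner_eq_zero {x : E}
    (hx : x ∈ vectorSpan ℝ (Set.range S.points))
    (h : inner ℝ (outwardUnitNormal S i) x = 0) :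
    x ∈ vectorSpan ℝ (Set.range (S.faceOpposite i).points) := by
  set p := (S.faceOpposite i).points 0
  have hpF : p ∈ affineSpan ℝ (Set.range (S.faceOpposite i).points) :=
    mem_affineSpan ℝ (Set.mem_range_self 0)
  have hq : x + p ∈ affineSpan ℝ (Set.range S.points) :=
    vadd_mem_affineSpan_of_mem_affineSpan_of_mem_vectorSpan
      (S.affineSpan_faceOpposite_le i hpF) hx
  obtain ⟨w, hw, hwq⟩ := eq_affineCombination_of_mem_affineSpan_of_fintype hq
  have h1 : inner ℝ (outwardUnitNormal S i) (x + p - S.points i) = S.height i := by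
    rw [add_sub_assoc, inner_add_right, h, zero_add, inner_outwardUnitNormal_sub S i hpF]
  rw [hwq, inner_outwardUnitNormal_affineCombination_sub w hw] at h1
  have hwi : w i = 0 := by
    have := S.height_pos i
    have h2 : w i * S.height i = 0 := by linarith
    simpa [this.ne'] using h2
  have h3 : x + p ∈ affineSpan ℝ (Set.range (S.faceOpposite i).points) := by
    rw [hwq, S.affineCombination_mem_affineSpan_faceOpposite_iff hw, hwi]
  simpa using vsub_mem_vectorSpan_of_mem_affineSpan_of_mem_affineSpan h3 hpF

end Normal

/-- The foot of the altitude in the subsimplex also lies in the facet hyperplane of `S`, to which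
`S.height` is the distance. -/
theorem height_le_height_subsimplex {m : ℕ} [NeZero k] [NeZero m] (S : Affine.Simplex ℝ E k)
    (e : Fin (m + 1) ↪o Fin (k + 1)) (i : Fin (m + 1)) :
    S.height (e i) ≤ (subsimplex S e).height i := by
  rw [Affine.Simplex.height.eq_def (subsimplex S e), dist_comm, dist_eq_norm]
  refine height_le_norm_sub (affineSpan_mono ℝ ?_
    ((subsimplex S e).altitudeFoot_mem_affineSpan_faceOpposite i))
  rw [S.range_faceOpposite_points, Affine.Simplex.range_faceOpposite_points]
  rintro _ ⟨j, hj, rfl⟩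
  exact ⟨e j, by simpa using hj, rfl⟩

theorem height_le_height_faceOpposite (S : Affine.Simplex ℝ E (n + 2)) (i : Fin (n + 3))
    (j : Fin (n + 2)) :
    S.height (i.succAbove j) ≤ Affine.Simplex.height (n := n + 1) (S.faceOpposite i) j := by
  rw [faceOpposite_eq_subsimplex]
  exact height_le_height_subsimplex S i.succAboveOrderEmb j

section Dihedral

theorem abs_inner_outwardUnitNormal_le_one [NeZero k] (S : Affine.Simplex ℝ E k)
    (i j : Fin (k + 1)) : |inner ℝ (outwardUnitNormal S i) (outwardUnitNormal S j)| ≤ 1 := by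
  have := abs_real_inner_le_norm (outwardUnitNormal S i) (outwardUnitNormal S j)
  rwa [norm_outwardUnitNormal, norm_outwardUnitNormal, one_mul] at this

theorem cos_dihedralAngle [k.AtLeastTwo] (S : Affine.Simplex ℝ E k) (i j : Fin (k + 1)) :
    Real.cos (dihedralAngle S i j) =
      -inner ℝ (outwardUnitNormal S i) (outwardUnitNormal S j) := by
  have := abs_le.1 (abs_inner_outwardUnitNormal_le_one S i j)
  exact Real.cos_arccos (by linarith) (by linarith)

theorem sin_dihedralAngle_nonneg [k.AtLeastTwo] (S : Affine.Simplex ℝ E k) (i j : Fin (k + 1)) :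
    0 ≤ Real.sin (dihedralAngle S i j) :=
  Real.sin_nonneg_of_nonneg_of_le_pi (Real.arccos_nonneg _) (Real.arccos_le_pi _)

theorem dihedralAngle_comm [k.AtLeastTwo] (S : Affine.Simplex ℝ E k) (i j : Fin (k + 1)) :
    dihedralAngle S i j = dihedralAngle S j i := by
  rw [dihedralAngle, real_inner_comm, dihedralAngle]

/-- The height of a simplex over the facet `i` is the height of the facet `j` over the common
ridge, times the sine of the dihedral angle. -/
theorem height_eq_sin_dihedralAngle_mul (S : Affine.Simplex ℝ E (n + 2)) (j : Fin (n + 3))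
    (i : Fin (n + 2)) :
    S.height (j.succAbove i) = Real.sin (dihedralAngle S (j.succAbove i) j) *
      Affine.Simplex.height (n := n + 1) (S.faceOpposite j) i := by
  set F : Affine.Simplex ℝ E (n + 1) := S.faceOpposite j with hF
  set a := outwardUnitNormal S (j.succAbove i)
  set b := outwardUnitNormal S j
  set c := outwardUnitNormal F i
  have hS := isOutwardUnitNormal_outwardUnitNormal S (j.succAbove i)
  have hb := isOutwardUnitNormal_outwardUnitNormal S j
  have hc := isOutwardUnitNormal_outwardUnitNormal F i
  have hridge : Set.range (F.faceOpposite i).points ⊆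
      Set.range (S.faceOpposite (j.succAbove i)).points := by
    rw [S.range_faceOpposite_points, F.range_faceOpposite_points]
    rintro _ ⟨l, hl, rfl⟩
    exact ⟨j.succAbove l, by simpa using hl, (faceOpposite_points S j l).symm⟩
  have hFb : ∀ x ∈ vectorSpan ℝ (Set.range F.points), inner ℝ b x = 0 := hb.orthogonal
  -- The part of `a` orthogonal to `b` lies in the direction of the facet `F` and is orthogonal to
  -- the ridge, so it is a multiple of `c`; the multiple turns out to be the sine.
  set w := a - inner ℝ b a • b with hw
  have hwF : w ∈ vectorSpan ℝ (Set.range F.points) := by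
    refine mem_vectorSpan_faceOpposite_of_inner_eq_zero
      (Submodule.sub_mem _ hS.mem_vectorSpan (Submodule.smul_mem _ _ hb.mem_vectorSpan)) ?_
    change inner ℝ b w = 0
    rw [hw, inner_sub_right, inner_smul_right, real_inner_self_eq_norm_sq, hb.norm_eq_one]
    ring
  have hwridge : ∀ x ∈ vectorSpan ℝ (Set.range (F.faceOpposite i).points), inner ℝ w x = 0 := by
    intro x hx
    have h1 : inner ℝ a x = 0 := hS.orthogonal x (vectorSpan_mono ℝ hridge hx)
    have h2 : inner ℝ b x = 0 := by
      refine hFb x (vectorSpan_mono ℝ ?_ hx)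
      rw [F.range_faceOpposite_points]
      exact Set.image_subset_range _ _
    rw [hw, inner_sub_left, inner_smul_left, h1, h2]
    simp
  have hwc : w = inner ℝ c w • c := by
    have h1 : w - inner ℝ c w • c ∈ vectorSpan ℝ (Set.range (F.faceOpposite i).points) := by
      refine mem_vectorSpan_faceOpposite_of_inner_eq_zero
        (Submodule.sub_mem _ hwF (Submodule.smul_mem _ _ hc.mem_vectorSpan)) ?_
      change inner ℝ c _ = 0
      rw [inner_sub_right, inner_smul_right, real_inner_self_eq_norm_sq, hc.norm_eq_one]
      ring
    have h2 : inner ℝ (w - inner ℝ c w • c) (w - inner ℝ c w • c) = 0 := by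
      rw [inner_sub_left, inner_smul_left, hwridge _ h1, hc.orthogonal _ h1]
      simp
    exact sub_eq_zero.1 (inner_self_eq_zero.1 h2)
  have hcw : inner ℝ c w * F.height i = S.height (j.succAbove i) := by
    have h1 : inner ℝ a (F.altitudeFoot i - F.points i) = S.height (j.succAbove i) := by
      have h := inner_outwardUnitNormal_sub S (j.succAbove i)
        (affineSpan_mono ℝ hridge (F.altitudeFoot_mem_affineSpan_faceOpposite i))
      rwa [← faceOpposite_points] at h
    rw [← height_smul_outwardUnitNormal, inner_smul_right] at h1
    rw [hw, inner_sub_right, inner_smul_right, real_inner_comm, real_inner_comm b c,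
      hFb c hc.mem_vectorSpan, ← h1]
    ring
  have hpos := F.height_pos i
  have hcw0 : 0 ≤ inner ℝ c w := by
    have := S.height_pos (j.succAbove i)
    rw [← hcw] at this
    exact (pos_of_mul_pos_left this hpos.le).le
  have hsin : inner ℝ c w = Real.sin (dihedralAngle S (j.succAbove i) j) := by
    rw [← sq_eq_sq₀ hcw0 (sin_dihedralAngle_nonneg S _ _), Real.sin_sq, cos_dihedralAngle]
    have h1 : ‖w‖ ^ 2 = inner ℝ c w ^ 2 := by
      conv_lhs => rw [hwc, norm_smul, hc.norm_eq_one, mul_one, Real.norm_eq_abs, sq_abs]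
    rw [← h1, hw, norm_sub_sq_real, norm_smul, inner_smul_right, hS.norm_eq_one, hb.norm_eq_one,
      mul_one, Real.norm_eq_abs, sq_abs, real_inner_comm b a]
    ring
  rw [← hsin, hcw]

/-- The barycentric coordinates of the foot of an altitude, in terms of dihedral angles. -/
theorem exists_weights_height_mul_cos_dihedralAngle [k.AtLeastTwo] (S : Affine.Simplex ℝ E k)
    (i : Fin (k + 1)) : ∃ w : Fin (k + 1) → ℝ, ∑ j, w j = 1 ∧ w i = 0 ∧
      ∀ j ≠ i, S.height i * Real.cos (dihedralAngle S i j) = w j * S.height j := by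
  obtain ⟨w, hw, hwf⟩ :=
    eq_affineCombination_of_mem_affineSpan_of_fintype (S.altitudeFoot_mem_affineSpan i)
  refine ⟨w, hw, ?_, fun j hj ↦ ?_⟩
  · rw [← S.affineCombination_mem_affineSpan_faceOpposite_iff hw, ← hwf]
    exact S.altitudeFoot_mem_affineSpan_faceOpposite i
  -- Evaluate the component of the foot along the normal `j` twice: by barycentric coordinates, and
  -- by going through vertex `i`.
  · have h1 := inner_outwardUnitNormal_affineCombination_sub (S := S) (i := j) w hw
    rw [← hwf, show S.altitudeFoot i - S.points j =
      (S.altitudeFoot i - S.points i) + (S.points i - S.points j) by abel, inner_add_right,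
      inner_outwardUnitNormal_points_sub hj.symm, ← height_smul_outwardUnitNormal,
      inner_smul_right, real_inner_comm] at h1
    rw [cos_dihedralAngle]
    linarith

end Dihedral

end Geometry

/-! ### Dihedral angles and height regularity -/

section Regular

variable {E : Type*} [NormedAddCommGroup E] [InnerProductSpace ℝ E] {k n : ℕ}

/-- All heights of `S` are at least `c` times each edge of `S`. -/
def HeightRegular [NeZero k] (c : ℝ) (S : Affine.Simplex ℝ E k) : Prop :=
  ∀ i p q, c * dist (S.points p) (S.points q) ≤ S.height i

/-- All dihedral angles of all subsimplices of `S` are at least `α`. -/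
def DihedralAnglesGE (α : ℝ) (S : Affine.Simplex ℝ E k) : Prop :=
  ∀ (m : ℕ) [m.AtLeastTwo] (e : Fin (m + 1) ↪o Fin (k + 1)) (i j : Fin (m + 1)),
    i ≠ j → α ≤ dihedralAngle (subsimplex S e) i j

theorem dihedralAnglesGE_iff_face (α : ℝ) (S : Affine.Simplex ℝ E k) :
    DihedralAnglesGE α S ↔ ∀ (m : ℕ) [m.AtLeastTwo] (V : Finset (Fin (k + 1)))
      (hV : V.card = m + 1) (i j : Fin (m + 1)), i ≠ j → α ≤ dihedralAngle (S.face hV) i j := by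
  refine ⟨fun h m _ V hV i j hij ↦ h m (V.orderEmbOfFin hV) i j hij, fun h m _ e i j hij ↦ ?_⟩
  rw [subsimplex_eq_face]
  exact h m _ _ i j hij

theorem DihedralAnglesGE.subsimplex {α : ℝ} {S : Affine.Simplex ℝ E k} (h : DihedralAnglesGE α S)
    {m : ℕ} (e : Fin (m + 1) ↪o Fin (k + 1)) : DihedralAnglesGE α (subsimplex S e) :=
  fun l _ f i j hij ↦ h l (f.trans e) i j hij

theorem DihedralAnglesGE.mono {α β : ℝ} {S : Affine.Simplex ℝ E k} (h : DihedralAnglesGE α S)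
    (hβ : β ≤ α) : DihedralAnglesGE β S :=
  fun l _ f i j hij ↦ hβ.trans (h l f i j hij)

theorem DihedralAnglesGE.faceOpposite {α : ℝ} {S : Affine.Simplex ℝ E (n + 1)}
    (h : DihedralAnglesGE α S) (i : Fin (n + 2)) :
    DihedralAnglesGE (k := n) α (S.faceOpposite i) := by
  rw [faceOpposite_eq_subsimplex]
  exact h.subsimplex _

theorem DihedralAnglesGE.le_dihedralAngle [k.AtLeastTwo] {α : ℝ} {S : Affine.Simplex ℝ E k}
    (h : DihedralAnglesGE α S) {i j : Fin (k + 1)} (hij : i ≠ j) : α ≤ dihedralAngle S i j :=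
  h k (OrderIso.refl _).toOrderEmbedding i j hij

/-- If all dihedral angles are at least `α` and the facets are `c`-regular, then the simplex is
regular with a constant depending on `α`, `c` and the dimension. -/
theorem heightRegular_of_faceOpposite {α c : ℝ} (hα : 0 < α) (hα' : α ≤ Real.pi / 2) (hc : 0 < c)
    (S : Affine.Simplex ℝ E (n + 2)) (hS : ∀ i j, i ≠ j → α ≤ dihedralAngle S i j)
    (hF : ∀ j, HeightRegular (k := n + 1) c (S.faceOpposite j)) :
    HeightRegular (Real.sin α * c / (2 * (n + 3))) S := by
  intro i
  obtain ⟨w, hw, hwi, hcos⟩ := exists_weights_height_mul_cos_dihedralAngle S i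
  -- The `n + 3` weights sum to one, so one of them is at least the average.
  obtain ⟨j, -, hj⟩ : ∃ j ∈ Finset.univ, (1 / (n + 3) : ℝ) ≤ w j := by
    refine Finset.exists_le_of_sum_le (s := Finset.univ) Finset.univ_nonempty ?_
    rw [hw]
    simp
    field_simp
    linarith
  have hn : (0 : ℝ) < 1 / (n + 3) := by positivity
  have hji : j ≠ i := by
    rintro rfl
    linarith
  obtain ⟨i', rfl⟩ := Fin.exists_succAbove_eq hji.symm
  obtain ⟨j', hj'⟩ := Fin.exists_succAbove_eq hji
  have hhi := height_eq_sin_dihedralAngle_mul S j i'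
  have hhj := height_eq_sin_dihedralAngle_mul S (j.succAbove i') j'
  have hFj := hF j
  have hFi := hF (j.succAbove i')
  have hwj := hcos j hji
  rw [hj', dihedralAngle_comm] at hhj
  have hβ := hS _ _ hji.symm
  set β := dihedralAngle S (j.succAbove i') j
  set Fj : Affine.Simplex ℝ E (n + 1) := S.faceOpposite j with hFjdef
  set Fi : Affine.Simplex ℝ E (n + 1) := S.faceOpposite (j.succAbove i') with hFidef
  have hi0 := S.height_pos (j.succAbove i')
  have hj0 := S.height_pos j
  have hFj0 := Fj.height_pos i'
  have hFi0 := Fi.height_pos j'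
  have hsin0 : 0 < Real.sin β := pos_of_mul_pos_left (hhi ▸ hi0) hFj0.le
  have hcos0 : 0 < Real.cos β := by
    refine pos_of_mul_pos_right (a := S.height (j.succAbove i')) ?_ hi0.le
    rw [hwj]
    exact mul_pos (hn.trans_le hj) hj0
  -- A positive cosine rules out obtuse angles, so the sine is monotone on the relevant range.
  have hβ2 : β ≤ Real.pi / 2 := by
    by_contra! h
    have := Real.cos_nonpos_of_pi_div_two_le_of_le h.le
      ((Real.arccos_le_pi _).trans (by linarith [Real.pi_pos]))
    linarith
  have hsin : Real.sin α ≤ Real.sin β :=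
    Real.sin_le_sin_of_le_of_le_pi_div_two (by linarith [Real.pi_pos]) hβ2 hβ
  have hs0 : 0 < Real.sin α := Real.sin_pos_of_pos_of_lt_pi hα (by linarith [Real.pi_pos])
  -- Both facets are measured over their common ridge: the factor `sin β` cancels from `h_j / (n +
  -- 3) ≤ w_j h_j = h_i cos β ≤ h_i`.
  have hcomp : 1 / (n + 3) * Fi.height j' ≤ Fj.height i' := by
    have h1 : 1 / (n + 3) * (Real.sin β * Fi.height j') ≤ Real.sin β * Fj.height i' := by
      rw [← hhi, ← hhj]
      calc 1 / (n + 3) * S.height j ≤ w j * S.height j := by gcongr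
        _ = S.height (j.succAbove i') * Real.cos β := hwj.symm
        _ ≤ S.height (j.succAbove i') := mul_le_of_le_one_right hi0.le (Real.cos_le_one _)
    refine le_of_mul_le_mul_left ?_ hsin0
    linarith
  set ε := Real.sin α * c / (n + 3) with hε
  have hεle : ε ≤ Real.sin α * c := by
    rw [hε]
    have : (0 : ℝ) ≤ n := n.cast_nonneg
    exact div_le_self (by positivity) (by linarith)
  have hεpos : 0 < ε := by positivity
  have hedge : ∀ p q, (p ≠ j ∧ q ≠ j) ∨ (p ≠ j.succAbove i' ∧ q ≠ j.succAbove i') →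
      ε * dist (S.points p) (S.points q) ≤ S.height (j.succAbove i') := by
    rintro p q (⟨hp, hq⟩ | ⟨hp, hq⟩)
    · obtain ⟨p, rfl⟩ := Fin.exists_succAbove_eq hp
      obtain ⟨q, rfl⟩ := Fin.exists_succAbove_eq hq
      have h := hFj i' p q
      rw [hFjdef, faceOpposite_points, faceOpposite_points, ← hFjdef] at h
      calc _ ≤ Real.sin α * c * dist (S.points (j.succAbove p)) (S.points (j.succAbove q)) := by
            gcongr
        _ = Real.sin α * (c * dist (S.points (j.succAbove p)) (S.points (j.succAbove q))) := by
            ring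
        _ ≤ Real.sin β * Fj.height i' := by gcongr
        _ = _ := hhi.symm
    · obtain ⟨p, rfl⟩ := Fin.exists_succAbove_eq hp
      obtain ⟨q, rfl⟩ := Fin.exists_succAbove_eq hq
      have h := hFi j' p q
      rw [hFidef, faceOpposite_points, faceOpposite_points, ← hFidef] at h
      set D := dist (S.points ((j.succAbove i').succAbove p))
        (S.points ((j.succAbove i').succAbove q))
      calc ε * D = Real.sin α * (1 / (n + 3) * (c * D)) := by rw [hε]; ring
        _ ≤ Real.sin β * (1 / (n + 3) * Fi.height j') := by gcongr
        _ ≤ Real.sin β * Fj.height i' := by gcongr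
        _ = _ := hhi.symm
  have hε2 : Real.sin α * c / (2 * (n + 3)) = ε / 2 := by rw [hε]; field_simp
  rw [hε2]
  intro p q
  by_cases hpq : (p ≠ j ∧ q ≠ j) ∨ (p ≠ j.succAbove i' ∧ q ≠ j.succAbove i')
  · have := hedge p q hpq
    have : 0 ≤ ε * dist (S.points p) (S.points q) := by positivity
    linarith
  -- Only the edge joining `i` and `j` lies in neither facet; a detour through a third vertex costs
  -- the factor 2.
  · obtain ⟨l, hl⟩ : ∃ l, l ∉ ({j, j.succAbove i'} : Finset (Fin (n + 3))) := by
      by_contra! h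
      have h1 := Finset.card_le_two (a := j) (b := j.succAbove i')
      rw [Finset.eq_univ_iff_forall.2 h, Finset.card_fin] at h1
      lia
    simp only [Finset.mem_insert, Finset.mem_singleton, not_or] at hl
    have h1 := hedge p l (by grind)
    have h2 := hedge l q (by grind)
    have h3 := mul_le_mul_of_nonneg_left
      (dist_triangle (S.points p) (S.points l) (S.points q)) hεpos.le
    linarith

theorem heightRegular_one (S : Affine.Simplex ℝ E 1) : HeightRegular 1 S := by
  intro i p q
  rw [S.height_eq_dist, one_mul]
  fin_cases p <;> fin_cases q <;> simp [dist_comm]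

variable (E) in
/-- A lower bound on the dihedral angles of all subsimplices yields regularity. -/
theorem exists_heightRegular_of_dihedralAnglesGE {α : ℝ} (hα : 0 < α) (n : ℕ) :
    ∃ c : ℝ, 0 < c ∧ ∀ S : Affine.Simplex ℝ E (n + 1), DihedralAnglesGE α S →
      HeightRegular c S := by
  -- A larger bound may be weakened to `π / 2`.
  wlog hα' : α ≤ Real.pi / 2 generalizing α
  · obtain ⟨c, hc, h⟩ := this (α := Real.pi / 2) (by positivity) le_rfl
    exact ⟨c, hc, fun S hS ↦ h S (hS.mono (not_le.1 hα').le)⟩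
  induction n with
  | zero => exact ⟨1, one_pos, fun S _ ↦ heightRegular_one S⟩
  | succ n ih =>
    obtain ⟨c, hc, h⟩ := ih
    have hs0 : 0 < Real.sin α := Real.sin_pos_of_pos_of_lt_pi hα (by linarith [Real.pi_pos])
    exact ⟨_, by positivity, fun S hS ↦ heightRegular_of_faceOpposite hα hα' hc S
      (fun _ _ ↦ hS.le_dihedralAngle) fun j ↦ h _ (hS.faceOpposite j)⟩

theorem HeightRegular.subsimplex {m : ℕ} [NeZero k] [NeZero m] {c : ℝ}
    {S : Affine.Simplex ℝ E k} (h : HeightRegular c S) (e : Fin (m + 1) ↪o Fin (k + 1)) :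
    HeightRegular c (subsimplex S e) :=
  fun i p q ↦ (h (e i) (e p) (e q)).trans (height_le_height_subsimplex S e i)

/-- A facet height is at most an edge, so `height_eq_sin_dihedralAngle_mul` and regularity give `c ≤
sin β ≤ β`. -/
theorem HeightRegular.le_dihedralAngle {c : ℝ} {S : Affine.Simplex ℝ E (n + 2)}
    (h : HeightRegular c S) {i j : Fin (n + 3)} (hij : i ≠ j) : c ≤ dihedralAngle S i j := by
  obtain ⟨i, rfl⟩ := Fin.exists_succAbove_eq hij
  obtain ⟨l, hl⟩ : ∃ l, l ≠ i := exists_ne i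
  have h1 := height_eq_sin_dihedralAngle_mul S j i
  set F : Affine.Simplex ℝ E (n + 1) := S.faceOpposite j with hF
  have h2 : F.height i ≤ dist (F.points i) (F.points l) := height_le_dist hl
  have h3 := h (j.succAbove i) (j.succAbove i) (j.succAbove l)
  rw [← faceOpposite_points, ← faceOpposite_points, h1] at h3
  have h4 : Real.sin (dihedralAngle S (j.succAbove i) j) * F.height i ≤
      Real.sin (dihedralAngle S (j.succAbove i) j) * dist (F.points i) (F.points l) := by
    gcongr
    exact sin_dihedralAngle_nonneg _ _ _
  have h5 : c ≤ Real.sin (dihedralAngle S (j.succAbove i) j) :=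
    le_of_mul_le_mul_right (h3.trans h4) ((F.height_pos i).trans_le h2)
  exact h5.trans (Real.sin_le (Real.arccos_nonneg _))

theorem HeightRegular.dihedralAnglesGE [NeZero k] {c : ℝ} {S : Affine.Simplex ℝ E k}
    (h : HeightRegular c S) : DihedralAnglesGE c S := by
  intro m _ e i j hij
  obtain ⟨n, rfl⟩ := Nat.exists_eq_add_of_le' (Nat.AtLeastTwo.prop (n := m))
  exact (h.subsimplex e).le_dihedralAngle hij

end Regular

/-! ### Gram determinants -/

section Gram

variable {E : Type*} [NormedAddCommGroup E] [InnerProductSpace ℝ E] {n : ℕ}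

/-- Gram determinants are multiplicative along orthogonal decompositions of the first vector. -/
theorem det_gram_cons (w : Fin n → E) (q z : E) (hq : q ∈ Submodule.span ℝ (Set.range w))
    (hz : ∀ m, inner ℝ z (w m) = 0) :
    (Matrix.gram ℝ (Fin.cons (q + z) w : Fin (n + 1) → E)).det =
      ‖z‖ ^ 2 * (Matrix.gram ℝ w).det := by
  set u : Fin (n + 1) → E := Fin.cons (q + z) w with hu
  obtain ⟨c, rfl⟩ := (Submodule.mem_span_range_iff_exists_fun ℝ).1 hq
  have hsplit : Matrix.gram ℝ u = (Matrix.gram ℝ u).updateRow 0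
      ((fun j ↦ inner ℝ (∑ m, c m • w m) (u j)) + fun j ↦ inner ℝ z (u j)) := by
    ext i j
    refine Fin.cases ?_ (fun i ↦ ?_) i
    · simp [Matrix.updateRow_self, Matrix.gram_apply, hu, inner_add_left]
    · simp [Matrix.updateRow_ne]
  rw [hsplit, Matrix.det_updateRow_add]
  -- The vector `(1, -c)` witnesses the dependence of the first row on the others.
  have h1 : ((Matrix.gram ℝ u).updateRow 0
      fun j ↦ inner ℝ (∑ m, c m • w m) (u j)).det = 0 := by
    refine Matrix.exists_vecMul_eq_zero_iff.1 ⟨Fin.cons 1 (-c), ?_, ?_⟩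
    · intro h
      simpa using congrFun h 0
    · ext j
      simp [Matrix.vecMul, dotProduct, Fin.sum_univ_succ, Matrix.gram_apply, sum_inner,
        inner_smul_left, hu]
  have h2 : ((Matrix.gram ℝ u).updateRow 0 fun j ↦ inner ℝ z (u j)).det =
      ‖z‖ ^ 2 * (Matrix.gram ℝ w).det := by
    have hz0 : inner ℝ z (∑ m, c m • w m) = 0 := by simp [inner_sum, inner_smul_right, hz]
    rw [Matrix.det_succ_row_zero, Fin.sum_univ_succ]
    simp only [Matrix.updateRow_self]
    rw [Finset.sum_eq_zero (by simp [hu, hz])]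
    simp only [hu, Fin.cons_zero, inner_add_right, hz0, real_inner_self_eq_norm_sq]
    simp only [Fin.val_zero, pow_zero, one_mul, zero_add, add_zero]
    congr 2
  rw [h1, h2, zero_add]

end Gram

/-! ### Volumes of simplices -/

section Volume

open MeasureTheory

/-- The volume of the standard corner simplex. -/
noncomputable def cornerVolume (n : ℕ) : ℝ :=
  volume.real (convexHull ℝ (insert 0 (Set.range (EuclideanSpace.basisFun (Fin n) ℝ))))

theorem cornerVolume_pos (n : ℕ) : 0 < cornerVolume n := by
  rw [cornerVolume, measureReal_def]
  set s := insert 0 (Set.range (EuclideanSpace.basisFun (Fin n) ℝ)) with hs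
  refine ENNReal.toReal_pos ?_ ?_
  · have hint : (interior (convexHull ℝ s)).Nonempty := by
      rw [interior_convexHull_nonempty_iff_affineSpan_eq_top, ← SetLike.coe_set_eq, hs,
        affineSpan_insert_zero, ← OrthonormalBasis.coe_toBasis, Module.Basis.span_eq]
      rfl
    exact (Measure.measure_pos_of_nonempty_interior _ hint).ne'
  · refine (Bornology.IsBounded.measure_lt_top (isBounded_convexHull.2 ?_)).ne
    exact ((Set.finite_range _).insert 0).isBounded

variable {E : Type*} [NormedAddCommGroup E] [InnerProductSpace ℝ E] [MeasurableSpace E]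
  [BorelSpace E] {n : ℕ}

/-- `S` is a translate of the linear image of the corner simplex, and the squared volume factor of a
linear map is the Gram determinant of the images of an orthonormal basis. Only positivity of
`cornerVolume` is needed later, never its value. -/
theorem meas_eq_cornerVolume_mul (S : Affine.Simplex ℝ E n) (p : E) (w : Fin n → E)
    (hS : Set.range S.points = (p + ·) '' insert 0 (Set.range w)) :
    meas S = √(Matrix.gram ℝ w).det * cornerVolume n := by
  set b := EuclideanSpace.basisFun (Fin n) ℝ with hb
  set f : EuclideanSpace ℝ (Fin n) →ₗ[ℝ] E := b.toBasis.constr ℝ w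
  have hf : ∀ m, f (b m) = w m := fun m ↦ by
    rw [← b.coe_toBasis]
    exact b.toBasis.constr_basis ℝ w m
  have hset : S.closedInterior = (p + ·) '' (f '' convexHull ℝ (insert 0 (Set.range b))) := by
    rw [← Affine.Simplex.convexHull_eq_closedInterior, hS, LinearMap.image_convexHull,
      Set.image_insert_eq (f := f), map_zero, ← Set.range_comp, show ⇑f ∘ b = w from funext hf]
    have := (AffineEquiv.constVAdd ℝ E p).toAffineMap.image_convexHull (insert 0 (Set.range w))
    exact this.symm
  have hiso : Isometry (p + ·) := (IsometryEquiv.addLeft p).isometry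
  rw [meas, hset, hiso.euclideanHausdorffMeasure_image]
  have h := f.euclideanHausdorffMeasure_image_eq_normDet_mul_volume
    (convexHull ℝ (insert 0 (Set.range b)))
  rw [finrank_euclideanSpace_fin] at h
  have hdet := f.normDet_sq_eq_det_gram b
  simp only [hf] at hdet
  rw [h, ENNReal.toReal_mul, ENNReal.toReal_ofReal f.normDet_nonneg, cornerVolume,
    measureReal_def, ← hdet, RCLike.ofReal_real_eq_id, id, Real.sqrt_sq f.normDet_nonneg]

/-- The volume of a simplex is a constant times the height times the volume of the base. -/
theorem meas_eq_mul_height_mul_meas_faceOpposite (S : Affine.Simplex ℝ E (n + 1))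
    (i : Fin (n + 2)) :
    meas S = cornerVolume (n + 1) / cornerVolume n * S.height i *
      meas (k := n) (S.faceOpposite i) := by
  set F : Affine.Simplex ℝ E n := S.faceOpposite i with hF
  set w : Fin n → E := fun m ↦ F.points m.succ - F.points 0
  have hrF : Set.range F.points = (F.points 0 + ·) '' insert 0 (Set.range w) := by
    rw [Set.image_insert_eq, ← Set.range_comp, add_zero, Fin.range_fin_succ]
    congr 2
    ext m
    simp [w, Fin.tail]
  have hrS : Set.range S.points = insert (S.points i) (Set.range F.points) := by
    rw [hF, S.range_faceOpposite_points, ← Set.image_insert_eq, Set.insert_eq,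
      Set.union_compl_self, Set.image_univ]
  -- The apex vector splits at the altitude foot into a part in the span of the base edges and a
  -- part orthogonal to them, as `det_gram_cons` requires.
  have hq : S.altitudeFoot i - F.points 0 ∈ Submodule.span ℝ (Set.range w) := by
    have h := vsub_mem_vectorSpan_of_mem_affineSpan_of_mem_affineSpan
      (S.altitudeFoot_mem_affineSpan_faceOpposite i)
      (mem_affineSpan ℝ (Set.mem_range_self (f := F.points) 0))
    rw [vectorSpan_range_eq_span_range_vsub_right ℝ F.points 0] at h
    refine Submodule.span_le.2 ?_ h
    rintro _ ⟨m, rfl⟩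
    refine Fin.cases ?_ (fun m ↦ ?_) m
    · simp
    · exact Submodule.subset_span ⟨m, rfl⟩
  have hz : ∀ m, inner ℝ (S.points i - S.altitudeFoot i) (w m) = 0 := by
    intro m
    rw [← neg_sub, ← height_smul_outwardUnitNormal, inner_neg_left, inner_smul_left,
      (isOutwardUnitNormal_outwardUnitNormal S i).orthogonal (w m)
        (vsub_mem_vectorSpan ℝ (Set.mem_range_self m.succ) (Set.mem_range_self 0))]
    simp
  rw [meas_eq_cornerVolume_mul F _ w hrF,
    meas_eq_cornerVolume_mul S (F.points 0) (Fin.cons (S.points i - F.points 0) w),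
    show S.points i - F.points 0 =
      (S.altitudeFoot i - F.points 0) + (S.points i - S.altitudeFoot i) by abel,
    det_gram_cons w _ _ hq hz, Real.sqrt_mul (sq_nonneg _), Real.sqrt_sq (norm_nonneg _),
    ← dist_eq_norm, Affine.Simplex.height]
  · have := (cornerVolume_pos n).ne'
    field_simp
  · rw [hrS, hrF, Fin.range_cons, Set.insert_comm, Set.image_insert_eq (a := S.points i - F.points 0),
      add_sub_cancel]

theorem meas_zero (S : Affine.Simplex ℝ E 0) : meas S = cornerVolume 0 := by
  rw [meas_eq_cornerVolume_mul S (S.points 0) Fin.elim0]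
  · simp
  · ext x
    simp [eq_comm, Fin.exists_fin_one]

theorem meas_pos (S : Affine.Simplex ℝ E n) : 0 < meas S := by
  induction n with
  | zero => exact meas_zero S ▸ cornerVolume_pos 0
  | succ n ih =>
    rw [meas_eq_mul_height_mul_meas_faceOpposite S 0]
    have := cornerVolume_pos n
    have := cornerVolume_pos (n + 1)
    have := S.height_pos 0
    have := ih (S.faceOpposite 0)
    positivity

theorem meas_le {D : ℝ} (S : Affine.Simplex ℝ E n)
    (hD : ∀ i j, dist (S.points i) (S.points j) ≤ D) : meas S ≤ cornerVolume n * D ^ n := by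
  induction n with
  | zero => simp [meas_zero]
  | succ n ih =>
    have hF := ih (S.faceOpposite 0) fun i j ↦ by
      rw [faceOpposite_points, faceOpposite_points]
      exact hD _ _
    have h0 := cornerVolume_pos n
    have h1 := cornerVolume_pos (n + 1)
    have hh : S.height 0 ≤ D := (height_le_dist Fin.zero_ne_one.symm).trans (hD 0 1)
    have hh0 := S.height_pos 0
    have hm := meas_pos (n := n) (S.faceOpposite 0)
    rw [meas_eq_mul_height_mul_meas_faceOpposite S 0]
    calc _ ≤ cornerVolume (n + 1) / cornerVolume n * D * (cornerVolume n * D ^ n) := by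
          gcongr
          have := hh0.le.trans hh
          positivity
      _ = _ := by rw [pow_succ']; field_simp

theorem le_meas_of_le_height {a : ℝ} (ha : 0 ≤ a) (S : Affine.Simplex ℝ E (n + 1))
    (h : ∀ i, a ≤ S.height i) : cornerVolume (n + 1) * a ^ (n + 1) ≤ meas S := by
  induction n with
  | zero =>
    have h0 := cornerVolume_pos 0
    have h1 := cornerVolume_pos 1
    rw [meas_eq_mul_height_mul_meas_faceOpposite S 0, meas_zero, mul_right_comm,
      div_mul_cancel₀ _ h0.ne']
    simpa using mul_le_mul_of_nonneg_left (h 0) h1.le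
  | succ n ih =>
    have hF := ih (S.faceOpposite 0) fun j ↦
      (h _).trans (height_le_height_faceOpposite S 0 j)
    have h0 := cornerVolume_pos (n + 1)
    have h1 := cornerVolume_pos (n + 2)
    have := h 0
    rw [meas_eq_mul_height_mul_meas_faceOpposite S 0]
    calc cornerVolume (n + 2) * a ^ (n + 2) = cornerVolume (n + 2) / cornerVolume (n + 1) * a *
          (cornerVolume (n + 1) * a ^ (n + 1)) := by rw [pow_succ' a (n + 1)]; field_simp
      _ ≤ _ := by
        gcongr

/-- The volume is bounded below by an edge times the product of the heights from the vertices
that do not lie on this edge, up to a constant. -/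
theorem mul_dist_mul_prod_le_meas (S : Affine.Simplex ℝ E (n + 1)) {i j : Fin (n + 2)}
    (hij : i ≠ j) (b : Fin (n + 2) → ℝ) (hb : ∀ m, 0 ≤ b m) (hi : b i = 1) (hj : b j = 1)
    (h : ∀ m, m ≠ i → m ≠ j → b m ≤ S.height m) :
    cornerVolume (n + 1) * dist (S.points i) (S.points j) * ∏ m, b m ≤ meas S := by
  induction n with
  | zero =>
    have h0 := cornerVolume_pos 0
    have hb1 : ∀ m, b m = 1 := fun m ↦ by
      obtain rfl | rfl : m = i ∨ m = j := by lia
      · exact hi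
      · exact hj
    have hdist : dist (S.points i) (S.points j) = dist (S.points 0) (S.points 1) := by
      fin_cases i <;> fin_cases j <;> simp_all [dist_comm]
    rw [meas_eq_mul_height_mul_meas_faceOpposite S 0, meas_zero, S.height_eq_dist, hdist,
      mul_right_comm _ (dist _ _) (cornerVolume 0), div_mul_cancel₀ _ h0.ne']
    simp [hb1]
  | succ n ih =>
    -- Peel off a vertex away from the edge, keeping the edge in the facet for the induction.
    obtain ⟨l, hl⟩ : ∃ l, l ∉ ({i, j} : Finset (Fin (n + 3))) := by
      by_contra! h
      have h1 := Finset.card_le_two (a := i) (b := j)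
      rw [Finset.eq_univ_iff_forall.2 h, Finset.card_fin] at h1
      lia
    simp only [Finset.mem_insert, Finset.mem_singleton, not_or] at hl
    have hl' := h l hl.1 hl.2
    obtain ⟨i, rfl⟩ := Fin.exists_succAbove_eq (Ne.symm hl.1)
    obtain ⟨j, rfl⟩ := Fin.exists_succAbove_eq (Ne.symm hl.2)
    have hF := ih (S.faceOpposite l) (i := i) (j := j) (by simpa using hij)
      (fun m ↦ b (l.succAbove m)) (fun m ↦ hb _) hi hj fun m hmi hmj ↦
        (h _ (by simpa using hmi) (by simpa using hmj)).trans
          (height_le_height_faceOpposite S l m)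
    rw [faceOpposite_points, faceOpposite_points] at hF
    have h0 := cornerVolume_pos (n + 1)
    have h1 := cornerVolume_pos (n + 2)
    rw [meas_eq_mul_height_mul_meas_faceOpposite S l, Fin.prod_univ_succAbove _ l]
    set D := dist (S.points (l.succAbove i)) (S.points (l.succAbove j))
    set P := ∏ m, b (l.succAbove m)
    have hP : 0 ≤ P := Finset.prod_nonneg fun m _ ↦ hb _
    calc cornerVolume (n + 2) * D * (b l * P) = cornerVolume (n + 2) / cornerVolume (n + 1) * b l *
          (cornerVolume (n + 1) * D * P) := by field_simp
      _ ≤ _ := by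
        gcongr

end Volume

/-! ### The `d`-sine and height regularity -/

section Sine

variable {E : Type*} [NormedAddCommGroup E] [InnerProductSpace ℝ E] [MeasurableSpace E]
  [BorelSpace E] {n : ℕ}

theorem dSine_def (S : Affine.Simplex ℝ E (n + 2)) (i : Fin (n + 3)) :
    dSine S i = ((n + 2 : ℕ) : ℝ) ^ (n + 1) * meas S ^ (n + 1) /
      (((n + 1).factorial : ℝ) *
        ∏ j ∈ Finset.univ.erase i, meas (k := n + 1) (S.faceOpposite j)) := rfl

variable (E) in
/-- Regular simplices have sines bounded below. -/
theorem exists_le_dSine_of_heightRegular {c : ℝ} (hc : 0 < c) (n : ℕ) :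
    ∃ C : ℝ, 0 < C ∧ ∀ S : Affine.Simplex ℝ E (n + 2), HeightRegular c S → ∀ i, C ≤ dSine S i := by
  have h1 := cornerVolume_pos (n + 1)
  have h2 := cornerVolume_pos (n + 2)
  refine ⟨((n + 2 : ℕ) : ℝ) ^ (n + 1) * (cornerVolume (n + 2) * c ^ (n + 2)) ^ (n + 1) /
    (((n + 1).factorial : ℝ) * cornerVolume (n + 1) ^ (n + 2)), by positivity, fun S hS i ↦ ?_⟩
  -- `D` is the longest edge.
  obtain ⟨⟨p, q⟩, hpq⟩ := Finite.exists_max fun x : Fin (n + 3) × Fin (n + 3) ↦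
    dist (S.points x.1) (S.points x.2)
  set D := dist (S.points p) (S.points q)
  have hDpos : 0 < D :=
    ((S.height_pos 0).trans_le (height_le_dist Fin.zero_ne_one.symm)).trans_le (hpq (0, 1))
  have hV := le_meas_of_le_height (by positivity) S fun i ↦ hS i p q
  have hF : ∀ j, meas (k := n + 1) (S.faceOpposite j) ≤ cornerVolume (n + 1) * D ^ (n + 1) := by
    intro j
    refine meas_le _ fun i l ↦ ?_
    rw [faceOpposite_points, faceOpposite_points]
    exact hpq (_, _)
  have hprod : ∏ j ∈ Finset.univ.erase i, meas (k := n + 1) (S.faceOpposite j) ≤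
      (cornerVolume (n + 1) * D ^ (n + 1)) ^ (n + 2) := by
    refine (Finset.prod_le_prod (fun j _ ↦ (meas_pos _).le) fun j _ ↦ hF j).trans_eq ?_
    simp
  have hprod0 : 0 < ∏ j ∈ Finset.univ.erase i, meas (k := n + 1) (S.faceOpposite j) :=
    Finset.prod_pos fun j _ ↦ meas_pos _
  rw [dSine_def]
  -- Numerator and denominator both carry `D ^ ((n + 1) * (n + 2))`, which makes the bound scale
  -- invariant.
  calc _ = ((n + 2 : ℕ) : ℝ) ^ (n + 1) * (cornerVolume (n + 2) * (c * D) ^ (n + 2)) ^ (n + 1) /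
        (((n + 1).factorial : ℝ) * (cornerVolume (n + 1) * D ^ (n + 1)) ^ (n + 2)) := by
        rw [mul_pow c D, mul_pow _ (D ^ (n + 1)), ← mul_assoc (cornerVolume (n + 2)),
          mul_pow _ (D ^ (n + 2)), ← pow_mul D, ← pow_mul D, mul_comm (n + 2) (n + 1)]
        field_simp
    _ ≤ _ := by
        have := meas_pos S
        gcongr

variable (E) in
/-- The sine at the vertex `i` is bounded by the height from any other vertex `j` divided by the
edge from `i` to `j`, up to a constant. -/
theorem exists_dSine_mul_dist_le (n : ℕ) : ∃ B : ℝ, 0 < B ∧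
    ∀ (S : Affine.Simplex ℝ E (n + 2)) (i j : Fin (n + 3)), i ≠ j →
      dSine S i * dist (S.points i) (S.points j) ≤ B * S.height j := by
  have h1 := cornerVolume_pos (n + 1)
  have h2 := cornerVolume_pos (n + 2)
  set κ := cornerVolume (n + 2) / cornerVolume (n + 1)
  have hκ0 : 0 < κ := by positivity
  refine ⟨((n + 2 : ℕ) : ℝ) ^ (n + 1) / ((n + 1).factorial : ℝ) * κ ^ (n + 1) /
    cornerVolume (n + 1), by positivity, fun S i j hij ↦ ?_⟩
  obtain ⟨l, hl⟩ : ∃ l, l ∉ ({i, j} : Finset (Fin (n + 3))) := by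
    by_contra! h
    have h1 := Finset.card_le_two (a := i) (b := j)
    rw [Finset.eq_univ_iff_forall.2 h, Finset.card_fin] at h1
    lia
  simp only [Finset.mem_insert, Finset.mem_singleton, not_or] at hl
  set s : Finset (Fin (n + 3)) := (Finset.univ.erase i).erase l with hs
  have hls : l ∈ Finset.univ.erase i := by simpa using hl.1
  have hjs : j ∈ s := by simp [hs, hij.symm, Ne.symm hl.2]
  set μ : Fin (n + 3) → ℝ := fun m ↦ meas (k := n + 1) (S.faceOpposite m)
  have hμ0 : ∀ m, 0 < μ m := fun m ↦ meas_pos _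
  have hμprod : 0 < ∏ m ∈ s, μ m := Finset.prod_pos fun m _ ↦ hμ0 m
  set P := ∏ m ∈ s.erase j, S.height m
  -- The set `s` omits `i` and `l`, so it has exactly `n + 1` elements: one factor of the volume is
  -- expanded over each facet in `s`, and those facets cancel in the sine.
  have hV : meas S ^ (n + 1) = κ ^ (n + 1) * (S.height j * P) * ∏ m ∈ s, μ m := by
    have hcard : s.card = n + 1 := by simp [hs, Finset.card_erase_of_mem hls]
    rw [Finset.mul_prod_erase _ _ hjs, ← hcard, ← Finset.prod_const, ← Finset.prod_const,
      ← Finset.prod_mul_distrib, ← Finset.prod_mul_distrib]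
    exact Finset.prod_congr rfl fun m _ ↦ meas_eq_mul_height_mul_meas_faceOpposite S m
  -- The uncancelled facet `l` contains the edge from `i` to `j`, and its volume absorbs every
  -- height in `P`.
  have hFl : cornerVolume (n + 1) * dist (S.points i) (S.points j) * P ≤ μ l := by
    set b : Fin (n + 3) → ℝ := fun m ↦ if m = i ∨ m = j then 1 else S.height m with hb
    obtain ⟨i', rfl⟩ := Fin.exists_succAbove_eq (Ne.symm hl.1)
    obtain ⟨j', rfl⟩ := Fin.exists_succAbove_eq (Ne.symm hl.2)
    have hb0 : ∀ m, 0 < b m := fun m ↦ by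
      simp only [hb]
      split_ifs
      · exact one_pos
      · exact S.height_pos m
    have h := mul_dist_mul_prod_le_meas (S.faceOpposite l) (i := i') (j := j')
      (by simpa using hij) (fun m ↦ b (l.succAbove m)) (fun m ↦ (hb0 _).le)
      (by simp [hb]) (by simp [hb]) fun m hmi hmj ↦ by
        simp only [hb, Fin.succAbove_right_inj, hmi, hmj, or_self, if_false]
        exact height_le_height_faceOpposite S l m
    have hPb : ∏ m, b (l.succAbove m) = P := by
      have e1 : b l * ∏ m, b (l.succAbove m) = ∏ m, b m := (Fin.prod_univ_succAbove b l).symm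
      rw [← Finset.mul_prod_erase _ b (Finset.mem_univ (l.succAbove i')),
        ← Finset.mul_prod_erase _ b hls, ← Finset.mul_prod_erase _ b hjs] at e1
      have e2 : ∏ m ∈ s.erase (l.succAbove j'), b m = P := by
        refine Finset.prod_congr rfl fun m hm ↦ ?_
        have hm' : m ≠ l.succAbove j' ∧ m ≠ l ∧ m ≠ l.succAbove i' := by
          simpa [hs] using hm
        simp [hb, hm'.1, hm'.2.2]
      rw [e2, show b (l.succAbove i') = 1 by simp [hb], show b (l.succAbove j') = 1 by simp [hb],
        one_mul, one_mul] at e1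
      exact mul_left_cancel₀ (hb0 l).ne' e1
    rwa [faceOpposite_points, faceOpposite_points, hPb] at h
  have hsine : dSine S i = ((n + 2 : ℕ) : ℝ) ^ (n + 1) / ((n + 1).factorial : ℝ) * κ ^ (n + 1) *
      S.height j * (P / μ l) := by
    have e : ∏ m ∈ Finset.univ.erase i, meas (k := n + 1) (S.faceOpposite m) =
        μ l * ∏ m ∈ s, μ m := (Finset.mul_prod_erase _ μ hls).symm
    have := hμ0 l
    rw [dSine_def, hV, e]
    field_simp
  have hquot : P / μ l * dist (S.points i) (S.points j) ≤ 1 / cornerVolume (n + 1) := by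
    rw [div_mul_eq_mul_div, div_le_div_iff₀ (hμ0 l) h1]
    linarith
  have hj := S.height_pos j
  rw [hsine]
  calc _ = ((n + 2 : ℕ) : ℝ) ^ (n + 1) / ((n + 1).factorial : ℝ) * κ ^ (n + 1) * S.height j *
        (P / μ l * dist (S.points i) (S.points j)) := by ring
    _ ≤ ((n + 2 : ℕ) : ℝ) ^ (n + 1) / ((n + 1).factorial : ℝ) * κ ^ (n + 1) * S.height j *
        (1 / cornerVolume (n + 1)) := by gcongr
    _ = _ := by ring

variable (E) in
/-- A lower bound on the sines at all vertices yields regularity. -/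
theorem exists_heightRegular_of_le_dSine {C : ℝ} (hC : 0 < C) (n : ℕ) :
    ∃ c : ℝ, 0 < c ∧ ∀ S : Affine.Simplex ℝ E (n + 2), (∀ i, C ≤ dSine S i) →
      HeightRegular c S := by
  obtain ⟨B, hB, h⟩ := exists_dSine_mul_dist_le E n
  refine ⟨C / (2 * B), by positivity, fun S hS j p q ↦ ?_⟩
  have hedge : ∀ i, C * dist (S.points i) (S.points j) ≤ B * S.height j := by
    intro i
    obtain rfl | hij := eq_or_ne i j
    · have := S.height_pos i
      rw [dist_self, mul_zero]
      positivity
    · exact (mul_le_mul_of_nonneg_right (hS i) dist_nonneg).trans (h S i j hij)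
  have h1 := hedge p
  have h2 := hedge q
  have h3 := mul_le_mul_of_nonneg_left
    (dist_triangle_right (S.points p) (S.points q) (S.points j)) hC.le
  rw [div_mul_eq_mul_div, div_le_iff₀ (by positivity)]
  linarith

end Sine

end SimplicialMesh

theorem theorem2p7 (d : ℕ) [d.AtLeastTwo] (Ω : Set (EuclideanSpace ℝ (Fin d)))
    (hΩ : SimplicialMesh.IsPolytope Ω)
    (F : Set (Set (Affine.Simplex ℝ (EuclideanSpace ℝ (Fin d)) d)))
    (hF : ∀ T ∈ F, SimplicialMesh.IsSimplicialPartition Ω T) :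
    SimplicialMesh.MinimumAngleCondition F ↔
      SimplicialMesh.GeneralizedMinimumAngleCondition F := by
  obtain ⟨n, rfl⟩ := Nat.exists_eq_add_of_le' (Nat.AtLeastTwo.prop (n := d))
  constructor
  · rintro ⟨α, hα, h⟩
    -- The argument `n + 1` gives simplices of dimension `n + 2`.
    obtain ⟨c, hc, hreg⟩ := SimplicialMesh.exists_heightRegular_of_dihedralAnglesGE
      (EuclideanSpace ℝ (Fin (n + 2))) hα (n + 1)
    obtain ⟨C, hC, hsine⟩ := SimplicialMesh.exists_le_dSine_of_heightRegular
      (EuclideanSpace ℝ (Fin (n + 2))) hc n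
    exact ⟨C, hC, fun T hT S hS ↦ hsine S
      (hreg S ((SimplicialMesh.dihedralAnglesGE_iff_face α S).2 (h T hT S hS)))⟩
  · rintro ⟨C, hC, h⟩
    obtain ⟨c, hc, hreg⟩ := SimplicialMesh.exists_heightRegular_of_le_dSine
      (EuclideanSpace ℝ (Fin (n + 2))) hC n
    exact ⟨c, hc, fun T hT S hS ↦ (SimplicialMesh.dihedralAnglesGE_iff_face c S).1
      (hreg S (h T hT S hS)).dihedralAnglesGE⟩
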